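/- Fix an integer $d\ge 0$ and real numbers $0<p<P<1$. For every $n\ge 0$ let $V_n$ be a set of $n$ points and, for every non-empty subset $\sigma\subseteq V_n$, let a number $p^{(n)}_\sigma\in[p,P]$ be given. Let $K_n$ be the random simplicial complex with vertex set contained in $V_n$ which is constructed skeleton by skeleton as follows: each $v\in V_n$ is added as a vertex with probability $p^{(n)}_{\{v\}}$; then, inductively for $k\ge 1$, each subset $\sigma\subseteq V_n$ of $k+1$ points all of whose proper non-empty subsets have been added as simplices is added as a $k$-simplex with probability $p^{(n)}_\sigma$, all these choices being independent. Then $$\lim_{n\to\infty}\Pr\bigl(K_n\text{ is }d\text{-connected}\bigr)=1,$$ where a simplicial complex is $d$-connected if its geometric realization $X$ is non-empty and for every $0\le k\le d$ each continuous map $S^k\to X$ is null-homotopic. -/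

import Mathlib

open MeasureTheory ProbabilityTheory Filter Topology

/-- The geometric realization of a simplicial complex `K` with vertices in a finite set `ι`: the
points of `ι → ℝ` with nonnegative barycentric coordinates of sum `1` whose support is a simplex
of `K`, with the subspace topology. The vertices of `K` are the `v` with `{v} ∈ K`; not every
point of `ι` has to be a vertex. -/
def PreAbstractSimplicialComplex.realization {ι : Type*} [Fintype ι]
    (K : PreAbstractSimplicialComplex ι) : Set (ι → ℝ) :=
  {x | x ∈ stdSimplex ℝ ι ∧ ∃ σ ∈ K, ∀ i, i ∈ σ ↔ x i ≠ 0}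

/-- A topological space `X` is `d`-connected if it is nonempty and every continuous map from the
sphere `S^k` to `X` is null-homotopic, for all `0 ≤ k ≤ d`. Here `S^k` is the unit sphere of the
Euclidean space of dimension `k + 1`. -/
def IsDConnected (d : ℕ) (X : Type*) [TopologicalSpace X] : Prop :=
  Nonempty X ∧ ∀ k ≤ d,
    ∀ f : C(Metric.sphere (0 : EuclideanSpace ℝ (Fin (k + 1))) 1, X), f.Nullhomotopic

/-- The simplicial complex produced by the outcomes `ω` of the coin tosses, one for each nonempty
`σ ⊆ ι`: a simplex is added when its boundary has been added and its own coin succeeds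
(see `mem_complexOfCoins_iff`), so the simplices are the nonempty `σ` all of whose nonempty
subsets have successful coins. -/
def complexOfCoins {ι : Type*} (ω : {σ : Finset ι // σ.Nonempty} → Bool) :
    PreAbstractSimplicialComplex ι where
  faces := {σ | σ.Nonempty ∧ ∀ τ : {τ : Finset ι // τ.Nonempty}, τ.1 ⊆ σ → ω τ = true}
  isRelLowerSet_faces := fun _ hσ =>
    ⟨hσ.1, fun _ hτσ hτ => ⟨hτ, fun ρ hρ => hσ.2 ρ (hρ.trans hτσ)⟩⟩

/-- The step of the construction: a nonempty `σ` is a simplex if and only if all its proper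
nonempty faces are simplices and the coin of `σ` succeeds. -/
theorem mem_complexOfCoins_iff {ι : Type*} (ω : {σ : Finset ι // σ.Nonempty} → Bool)
    (σ : {σ : Finset ι // σ.Nonempty}) :
    σ.1 ∈ complexOfCoins ω ↔
      (∀ τ : Finset ι, τ.Nonempty → τ ⊂ σ.1 → τ ∈ complexOfCoins ω) ∧ ω σ = true := by
  constructor
  · intro h
    exact ⟨fun τ hτ hτσ => ((complexOfCoins ω).isRelLowerSet_faces h).2 hτσ.subset hτ,
      h.2 σ (Finset.Subset.refl _)⟩
  · rintro ⟨h1, h2⟩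
    refine ⟨σ.2, fun τ hτσ => ?_⟩
    rcases hτσ.eq_or_ssubset with h | h
    · rwa [Subtype.ext h]
    · exact (h1 τ.1 τ.2 h).2 τ (Finset.Subset.refl _)

/-- The law of the independent coin tosses: the coin of `σ` succeeds with probability `p σ`. -/
noncomputable def coinMeasure {ι : Type*} [Fintype ι]
    (p : {σ : Finset ι // σ.Nonempty} → unitInterval) :
    Measure ({σ : Finset ι // σ.Nonempty} → Bool) :=
  Measure.pi fun σ => bernoulliMeasure true false (p σ)

/-- The multiparameter random simplicial complex with vertices in the finite set `ι`:
`multiparameterProb p A` is the probability that it has the property `A`, when each simplex `σ`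
whose boundary is present is added with probability `p σ`, independently. -/
noncomputable def multiparameterProb {ι : Type*} [Fintype ι]
    (p : {σ : Finset ι // σ.Nonempty} → unitInterval)
    (A : PreAbstractSimplicialComplex ι → Prop) : ℝ :=
  (coinMeasure p).real {ω | A (complexOfCoins ω)}

namespace PreAbstractSimplicialComplex

variable {ι : Type*}

/-! Call `v` a cone point over `U` if adding `v` to any simplex spanned by points of `U`, or to `∅`,
gives a simplex. `HasCones r` asks for one over every set of at most `r` points. It holds with
probability tending to 1 for fixed `r`: candidates outside `U` depend on disjoint sets of at most `2
^ r` coins, so all fail with exponentially small probability, which beats the polynomially many `U`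
(`tendsto_coinMeasure_real_not_hasCones`).

Deterministically, `r = 5 ^ D + 3 ^ D` with `D = d + 1` forces `d`-connectedness. A map from a
sphere in `ℝ ^ D` is approximated by labelling the cubes of a fine grid with vertices. Doubling the
mesh, each new label is a cone point over boundedly many neighbouring labels, so the map moves along
straight lines to a coarser one; at scale 1 a single cone finishes. The bound on `r` does not depend
on the initial mesh, hence not on the map. -/

theorem mem_of_subset {K : PreAbstractSimplicialComplex ι} {σ τ : Finset ι} (hσ : σ ∈ K)
    (hτσ : τ ⊆ σ) (hτ : τ.Nonempty) : τ ∈ K :=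
  (K.isRelLowerSet_faces hσ).2 hτσ hτ

/-- Every set of at most `r` points of `ι` spans a subcomplex that lies in the link of some vertex,
up to simplices which already contain that vertex. -/
def HasCones [DecidableEq ι] (K : PreAbstractSimplicialComplex ι) (r : ℕ) : Prop :=
  ∀ U : Finset ι, U.card ≤ r → ∃ v, ∀ σ ⊆ U, σ = ∅ ∨ σ ∈ K → insert v σ ∈ K

theorem HasCones.mono [DecidableEq ι] {K : PreAbstractSimplicialComplex ι} {r s : ℕ}
    (h : K.HasCones s) (hrs : r ≤ s) : K.HasCones r :=
  fun U hU => h U (hU.trans hrs)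

/-! ### Greedy choice of cone points. -/

section Labels

variable [DecidableEq ι] {I J : Type*}

/-- A greedy choice of labels: the label of `j` is a cone point over the labels of its neighbours
in `I` and of its neighbours in `J` that precede it in the enumeration `e`. -/
theorem HasCones.exists_labels {K : PreAbstractSimplicialComplex ι} {r : ℕ} (hK : K.HasCones r)
    (e : J → ℕ) (w : I → ι) (N : J → Finset I) (N' : J → Finset J)
    (hN : ∀ j, (N j).card + (N' j).card ≤ r) :
    ∃ w' : J → ι, ∀ j,
      ∀ σ ⊆ (N j).image w ∪ ((N' j).filter fun i => e i < e j).image w',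
        σ = ∅ ∨ σ ∈ K → insert (w' j) σ ∈ K := by
  have hcone : ∃ c : Finset ι → ι, ∀ U : Finset ι, U.card ≤ r →
      ∀ σ ⊆ U, σ = ∅ ∨ σ ∈ K → insert (c U) σ ∈ K := by
    -- With the size bound inside the existential, `c` is total; oversized sets get an arbitrary
    -- point.
    have h : ∀ U : Finset ι, ∃ v, U.card ≤ r →
        ∀ σ ⊆ U, σ = ∅ ∨ σ ∈ K → insert v σ ∈ K := by
      intro U
      by_cases hU : U.card ≤ r
      · obtain ⟨v, hv⟩ := hK U hU
        exact ⟨v, fun _ => hv⟩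
      · obtain ⟨v, -⟩ := hK ∅ (by simp)
        exact ⟨v, fun h => absurd h hU⟩
    choose c hc using h
    exact ⟨c, hc⟩
  obtain ⟨c, hc⟩ := hcone
  have hwf : WellFounded fun i j : J => e i < e j := InvImage.wf e wellFounded_lt
  let w' : J → ι := hwf.fix fun j rec =>
    c ((N j).image w ∪ ((N' j).filter fun i => e i < e j).attach.image
      fun i : {i // i ∈ (N' j).filter fun i => e i < e j} =>
        rec i.1 (Finset.mem_filter.1 i.2).2)
  have hw' : ∀ j, w' j = c ((N j).image w ∪ ((N' j).filter fun i => e i < e j).image w') := by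
    intro j
    have h : ((N' j).filter fun i => e i < e j).image w' =
        ((N' j).filter fun i => e i < e j).attach.image fun i => w' i.1 := by
      ext x
      simp
    rw [h]
    exact hwf.fix_eq _ j
  refine ⟨w', fun j σ hσ hσK => ?_⟩
  rw [hw' j]
  refine hc _ ?_ σ hσ hσK
  calc _ ≤ ((N j).image w).card + (((N' j).filter fun i => e i < e j).image w').card :=
        Finset.card_union_le _ _
    _ ≤ (N j).card + (N' j).card :=
        add_le_add Finset.card_image_le
          (Finset.card_image_le.trans (Finset.card_le_card (Finset.filter_subset _ _)))
    _ ≤ r := hN j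

/-- Labels of mutually neighbouring indices span a simplex. -/
theorem image_union_image_mem [DecidableEq J] {K : PreAbstractSimplicialComplex ι} {e : J → ℕ}
    (he : Function.Injective e) {w : I → ι} {w' : J → ι} {N : J → Finset I} {N' : J → Finset J}
    (hw' : ∀ j, ∀ σ ⊆ (N j).image w ∪ ((N' j).filter fun i => e i < e j).image w',
        σ = ∅ ∨ σ ∈ K → insert (w' j) σ ∈ K)
    {A : Finset I} (hA : A.image w = ∅ ∨ A.image w ∈ K) (B : Finset J)
    (hAB : ∀ j ∈ B, A ⊆ N j) (hB : ∀ j ∈ B, B ⊆ N' j) :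
    A.image w ∪ B.image w' = ∅ ∨ A.image w ∪ B.image w' ∈ K := by
  -- Labels are added in the order of `e`: the last index has all the others as earlier neighbours,
  -- so its label cones off the simplex built so far.
  induction B using Finset.induction_on_max_value e with
  | empty => simpa using hA
  | insert j B hj hmax ih =>
    right
    have ih' := ih (fun i hi => hAB i (Finset.mem_insert_of_mem hi))
      fun i hi => (Finset.subset_insert _ _).trans (hB i (Finset.mem_insert_of_mem hi))
    have := hw' j (A.image w ∪ B.image w') ?_ ih'
    · rwa [Finset.image_insert, Finset.union_insert]
    · refine Finset.union_subset_union (Finset.image_subset_image (hAB j (by simp)))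
        (Finset.image_subset_image fun i hi => Finset.mem_filter.2 ⟨?_, ?_⟩)
      · exact hB j (by simp) (Finset.mem_insert_of_mem hi)
      · exact lt_of_le_of_ne (hmax i hi) fun h => hj (he h ▸ hi)

end Labels

/-! ### Straight-line homotopies and bump maps. -/

section Realization

variable [Fintype ι] {K : PreAbstractSimplicialComplex ι}

theorem mem_realization_of_support_subset {x : ι → ℝ} (hx : x ∈ stdSimplex ℝ ι) {σ : Finset ι}
    (hσ : σ ∈ K) (h : ∀ i, x i ≠ 0 → i ∈ σ) : x ∈ K.realization := by
  classical
  refine ⟨hx, Finset.univ.filter fun i => x i ≠ 0,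
    mem_of_subset hσ (fun i hi => h i (Finset.mem_filter.1 hi).2) ?_, by simp⟩
  by_contra hne
  rw [Finset.not_nonempty_iff_eq_empty, Finset.filter_eq_empty_iff] at hne
  have h1 := hx.2
  rw [Finset.sum_eq_zero fun i hi => not_not.1 (hne hi)] at h1
  exact zero_ne_one h1

variable {X : Type*} [TopologicalSpace X]

/-- Two maps into a realization are homotopic along straight lines if the supports of their values
always lie in a common simplex. -/
theorem homotopic_of_support_subset (f g : C(X, K.realization))
    (h : ∀ x, ∃ σ ∈ K, (∀ i, (f x).1 i ≠ 0 → i ∈ σ) ∧ ∀ i, (g x).1 i ≠ 0 → i ∈ σ) :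
    f.Homotopic g := by
  have hmem : ∀ q : unitInterval × X,
      (1 - (q.1 : ℝ)) • (f q.2).1 + (q.1 : ℝ) • (g q.2).1 ∈ K.realization := by
    intro q
    obtain ⟨σ, hσ, hf, hg⟩ := h q.2
    refine mem_realization_of_support_subset (convex_stdSimplex ℝ ι (f q.2).2.1 (g q.2).2.1
      (by linarith [q.1.2.2]) q.1.2.1 (by ring)) hσ fun i hi => ?_
    by_contra hiσ
    have h1 : (f q.2).1 i = 0 := by_contra fun h => hiσ (hf i h)
    have h2 : (g q.2).1 i = 0 := by_contra fun h => hiσ (hg i h)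
    simp [h1, h2] at hi
  exact ⟨{ toFun := fun q => ⟨_, hmem q⟩
           continuous_toFun := by fun_prop
           map_zero_left := fun x => by ext; simp
           map_one_left := fun x => by ext; simp }⟩

/-- The map into a realization given by a family of bump functions labelled by vertices. -/
theorem exists_map_of_bumps {J : Type*} (s : Finset J) (φ : J → X → ℝ)
    (hφ : ∀ j, Continuous (φ j)) (hnonneg : ∀ j x, 0 ≤ φ j x) (hpos : ∀ x, ∃ j ∈ s, 0 < φ j x)
    (w : J → ι) (hK : ∀ x, ∃ σ ∈ K, ∀ j, 0 < φ j x → w j ∈ σ) :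
    ∃ g : C(X, K.realization), ∀ x i, (g x).1 i ≠ 0 → ∃ j, 0 < φ j x ∧ w j = i := by
  classical
  have hsum : ∀ x, 0 < ∑ j ∈ s, φ j x := fun x =>
    Finset.sum_pos' (fun j _ => hnonneg j x) (hpos x)
  let G : X → ι → ℝ := fun x i => (∑ j ∈ s with w j = i, φ j x) / ∑ j ∈ s, φ j x
  have hG : ∀ x i, G x i ≠ 0 → ∃ j, 0 < φ j x ∧ w j = i := by
    intro x i hi
    obtain ⟨j, hj, hne⟩ := Finset.exists_ne_zero_of_sum_ne_zero
      (fun h : ∑ j ∈ s with w j = i, φ j x = 0 => hi (by simp only [G, h, zero_div]))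
    exact ⟨j, lt_of_le_of_ne (hnonneg j x) hne.symm, (Finset.mem_filter.1 hj).2⟩
  have hmem : ∀ x, G x ∈ K.realization := by
    intro x
    obtain ⟨σ, hσ, h⟩ := hK x
    refine mem_realization_of_support_subset ⟨fun i => ?_, ?_⟩ hσ fun i hi => ?_
    · exact div_nonneg (Finset.sum_nonneg fun j _ => hnonneg j x) (hsum x).le
    · simp only [G]
      rw [← Finset.sum_div, Finset.sum_fiberwise s w fun j => φ j x, div_self (hsum x).ne']
    · obtain ⟨j, hj, rfl⟩ := hG x i hi
      exact h j hj
  refine ⟨⟨fun x => ⟨G x, hmem x⟩, ?_⟩, hG⟩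
  refine Continuous.subtype_mk (continuous_pi fun i => Continuous.div ?_ ?_ fun x => (hsum x).ne') _
  · exact continuous_finsetSum _ fun j _ => hφ j
  · exact continuous_finsetSum _ fun j _ => hφ j

end Realization

end PreAbstractSimplicialComplex

/-! ### Overlapping lattice cubes. -/

/-- `y` lies in the open cube of side length `2` around the lattice point `c`. -/
def IsNearLattice {D : ℕ} (c : Fin D → ℤ) (y : Fin D → ℝ) : Prop :=
  dist y (fun i => (c i : ℝ)) < 1

theorem isNearLattice_iff {D : ℕ} {c : Fin D → ℤ} {y : Fin D → ℝ} :
    IsNearLattice c y ↔ ∀ i, |y i - c i| < 1 := by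
  simp [IsNearLattice, dist_pi_lt_iff, Real.dist_eq]

theorem isNearLattice_floor {D : ℕ} (y : Fin D → ℝ) : IsNearLattice (fun i => ⌊y i⌋) y := by
  refine isNearLattice_iff.2 fun i => ?_
  rw [abs_lt]
  constructor <;> linarith [Int.floor_le (y i), Int.lt_floor_add_one (y i)]

/-- The lattice points at distance at most `k` from `c` in each coordinate. -/
noncomputable def latticeBox {D : ℕ} (c : Fin D → ℤ) (k : ℕ) : Finset (Fin D → ℤ) :=
  Fintype.piFinset fun i => Finset.Icc (c i - k) (c i + k)

theorem card_latticeBox {D : ℕ} (c : Fin D → ℤ) (k : ℕ) :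
    (latticeBox c k).card = (2 * k + 1) ^ D := by
  have h : ∀ i, (c i + k + 1 - (c i - k)).toNat = 2 * k + 1 := fun i => by omega
  simp [latticeBox, Fintype.card_piFinset, h]

theorem mem_latticeBox_of_abs_sub_lt {D : ℕ} {c c' : Fin D → ℤ} {k : ℕ}
    (h : ∀ i, |(c' i : ℝ) - c i| < k + 1) : c' ∈ latticeBox c k := by
  refine Fintype.mem_piFinset.2 fun i => Finset.mem_Icc.2 ?_
  have h' : |c' i - c i| < k + 1 := by exact_mod_cast h i
  rw [abs_lt] at h'
  constructor <;> omega

theorem IsNearLattice.mem_latticeBox_one {D : ℕ} {c c' : Fin D → ℤ} {y : Fin D → ℝ}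
    (h : IsNearLattice c y) (h' : IsNearLattice c' y) : c' ∈ latticeBox c 1 := by
  refine mem_latticeBox_of_abs_sub_lt fun i => ?_
  have h1 := abs_lt.1 (isNearLattice_iff.1 h i)
  have h2 := abs_lt.1 (isNearLattice_iff.1 h' i)
  rw [abs_lt]
  constructor <;> push_cast <;> linarith

/-- Here `|c' - 2c| ≤ |c' - 2y| + 2|y - c| < 3` coordinatewise, so an integer difference is at most
2: this is the source of `5 ^ D`. -/
theorem IsNearLattice.mem_latticeBox_two {D : ℕ} {c c' : Fin D → ℤ} {y : Fin D → ℝ}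
    (h : IsNearLattice c y) (h' : IsNearLattice c' ((2 : ℝ) • y)) :
    c' ∈ latticeBox (fun i => 2 * c i) 2 := by
  refine mem_latticeBox_of_abs_sub_lt fun i => ?_
  have h1 := abs_lt.1 (isNearLattice_iff.1 h i)
  have h2 := abs_lt.1 (isNearLattice_iff.1 h' i)
  simp only [Pi.smul_apply, smul_eq_mul] at h2
  rw [abs_lt]
  constructor <;> push_cast <;> linarith

/-! ### Coarsening labellings to contract a map. -/

namespace PreAbstractSimplicialComplex

variable {ι : Type*} {K : PreAbstractSimplicialComplex ι} {X : Type*}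

/-- The labels of the lattice cubes that contain a given point of the image of `e` span a
simplex. -/
def IsLabelling {D : ℕ} (K : PreAbstractSimplicialComplex ι) (e : X → Fin D → ℝ)
    (w : (Fin D → ℤ) → ι) : Prop :=
  ∀ x, ∃ σ ∈ K, ∀ c, IsNearLattice c (e x) → w c ∈ σ

/-- A labelling of the lattice cubes at scale `1 / 2` is compatible with a labelling at
scale `1`. -/
theorem HasCones.exists_coarser_labelling [DecidableEq ι] {D : ℕ}
    (hK : K.HasCones (5 ^ D + 3 ^ D)) (e : X → Fin D → ℝ) {w : (Fin D → ℤ) → ι}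
    (hw : K.IsLabelling (fun x => (2 : ℝ) • e x) w) :
    ∃ w' : (Fin D → ℤ) → ι, ∀ x, ∃ σ ∈ K, (∀ c, IsNearLattice c ((2 : ℝ) • e x) → w c ∈ σ) ∧
      ∀ c, IsNearLattice c (e x) → w' c ∈ σ := by
  classical
  obtain ⟨w', hw'⟩ := hK.exists_labels (Encodable.encode (α := Fin D → ℤ)) w
    (fun c => latticeBox (fun i => 2 * c i) 2) (fun c => latticeBox c 1)
    (fun c => by simp [card_latticeBox])
  refine ⟨w', fun x => ?_⟩
  obtain ⟨σ, hσ, hwσ⟩ := hw x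
  have hc₀ := isNearLattice_floor (e x)
  set c₀ : Fin D → ℤ := fun i => ⌊e x i⌋
  let A := (latticeBox (fun i => 2 * c₀ i) 2).filter fun c => IsNearLattice c ((2 : ℝ) • e x)
  let B := (latticeBox c₀ 1).filter fun c => IsNearLattice c (e x)
  have hA : ∀ c, c ∈ A ↔ IsNearLattice c ((2 : ℝ) • e x) := fun c =>
    ⟨fun h => (Finset.mem_filter.1 h).2, fun h => Finset.mem_filter.2 ⟨hc₀.mem_latticeBox_two h, h⟩⟩
  have hB : ∀ c, c ∈ B ↔ IsNearLattice c (e x) := fun c =>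
    ⟨fun h => (Finset.mem_filter.1 h).2, fun h => Finset.mem_filter.2 ⟨hc₀.mem_latticeBox_one h, h⟩⟩
  have hAK : A.image w = ∅ ∨ A.image w ∈ K := by
    rcases (A.image w).eq_empty_or_nonempty with h | h
    · exact .inl h
    · exact .inr (mem_of_subset hσ (Finset.image_subset_iff.2 fun c hc => hwσ c ((hA c).1 hc)) h)
  refine ⟨A.image w ∪ B.image w', (image_union_image_mem Encodable.encode_injective hw' hAK B
    (fun j hj i hi => ((hB j).1 hj).mem_latticeBox_two ((hA i).1 hi))
    (fun j hj i hi => ((hB j).1 hj).mem_latticeBox_one ((hB i).1 hi))).resolve_left ?_, ?_, ?_⟩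
  · exact Finset.Nonempty.ne_empty
      ⟨w' c₀, Finset.mem_union_right _ (Finset.mem_image_of_mem _ ((hB _).2 hc₀))⟩
  · exact fun c hc => Finset.mem_union_left _ (Finset.mem_image_of_mem _ ((hA c).2 hc))
  · exact fun c hc => Finset.mem_union_right _ (Finset.mem_image_of_mem _ ((hB c).2 hc))

variable [Fintype ι] [TopologicalSpace X]

theorem IsLabelling.exists_map {D : ℕ} {e : X → Fin D → ℝ} (he : Continuous e)
    {k : ℕ} (hk : ∀ x i, |e x i| ≤ k) {w : (Fin D → ℤ) → ι} (hw : K.IsLabelling e w) :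
    ∃ g : C(X, K.realization), ∀ x i, (g x).1 i ≠ 0 → ∃ c, IsNearLattice c (e x) ∧ w c = i := by
  have hpos : ∀ c x, 0 < max 0 (1 - dist (e x) (fun i => (c i : ℝ))) ↔ IsNearLattice c (e x) := by
    intro c x
    simp [IsNearLattice]
  have hfloor : ∀ x, (fun i => ⌊e x i⌋) ∈ latticeBox (0 : Fin D → ℤ) k := by
    refine fun x => Fintype.mem_piFinset.2 fun i => Finset.mem_Icc.2 ?_
    have h := abs_le.1 (hk x i)
    constructor
    · rw [Int.le_floor]
      simpa using h.1
    · have : ((⌊e x i⌋ : ℤ) : ℝ) ≤ ((k : ℤ) : ℝ) := by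
        simpa using (Int.floor_le (e x i)).trans h.2
      simpa using Int.cast_le.1 this
  simpa only [hpos] using exists_map_of_bumps (K := K) (latticeBox (0 : Fin D → ℤ) k)
    (fun c x => max 0 (1 - dist (e x) (fun i => (c i : ℝ)))) (fun c => by fun_prop)
    (fun c x => le_max_left _ _)
    (fun x => ⟨_, hfloor x, (hpos _ x).2 (isNearLattice_floor (e x))⟩) w
    (fun x => by simpa only [hpos] using hw x)

/-- Descent on the scale. The hypothesis `hf` is what survives: `f` moves to the bump map of `w`,
whose supports share simplices with the next coarser labels. -/
theorem HasCones.nullhomotopic_of_labelling [DecidableEq ι] {D : ℕ}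
    (hK : K.HasCones (5 ^ D + 3 ^ D)) {e : X → Fin D → ℝ} (he : Continuous e)
    (hbd : ∀ x i, |e x i| ≤ 1) (m : ℕ) (w : (Fin D → ℤ) → ι) (f : C(X, K.realization))
    (hf : ∀ x, ∃ σ ∈ K, (∀ i, (f x).1 i ≠ 0 → i ∈ σ) ∧
      ∀ c, IsNearLattice c ((2 : ℝ) ^ m • e x) → w c ∈ σ) :
    f.Nullhomotopic := by
  have hbd' : ∀ n : ℕ, ∀ x i, |((2 : ℝ) ^ n • e x) i| ≤ (2 ^ n : ℕ) := by
    intro n x i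
    rw [Pi.smul_apply, smul_eq_mul, abs_mul, abs_of_pos (by positivity : (0 : ℝ) < 2 ^ n)]
    push_cast
    exact mul_le_of_le_one_right (by positivity) (hbd x i)
  have hstep : ∀ n : ℕ, ∀ w : (Fin D → ℤ) → ι, ∀ f : C(X, K.realization),
      (∀ x, ∃ σ ∈ K, (∀ i, (f x).1 i ≠ 0 → i ∈ σ) ∧
        ∀ c, IsNearLattice c ((2 : ℝ) ^ n • e x) → w c ∈ σ) →
      ∃ g : C(X, K.realization), f.Homotopic g ∧
        ∀ x i, (g x).1 i ≠ 0 → ∃ c, IsNearLattice c ((2 : ℝ) ^ n • e x) ∧ w c = i := by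
    intro n w f hf
    have hw : K.IsLabelling (fun x => (2 : ℝ) ^ n • e x) w := fun x =>
      (hf x).imp fun σ hσ => ⟨hσ.1, hσ.2.2⟩
    obtain ⟨g, hg⟩ := hw.exists_map (by fun_prop) (hbd' n)
    refine ⟨g, homotopic_of_support_subset f g fun x => ?_, hg⟩
    obtain ⟨σ, hσ, h1, h2⟩ := hf x
    refine ⟨σ, hσ, h1, fun i hi => ?_⟩
    obtain ⟨c, hc, rfl⟩ := hg x i hi
    exact h2 c hc
  induction m generalizing w f with
  | zero =>
    obtain ⟨g, hfg, hg⟩ := hstep 0 w f hf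
    -- At scale 1 the cubes meeting the image have centres in `{-1, 0, 1} ^ D`, so one cone point
    -- serves all their labels.
    obtain ⟨v, hv⟩ := hK ((latticeBox (0 : Fin D → ℤ) 1).image w)
      (Finset.card_image_le.trans (by simp [card_latticeBox]))
    have hvK : {v} ∈ K := by simpa using hv ∅ (by simp) (.inl rfl)
    let y : K.realization := ⟨Pi.single v 1, mem_realization_of_support_subset
      (single_mem_stdSimplex ℝ v) hvK (by simp [Pi.single_apply])⟩
    refine ⟨y, hfg.trans (homotopic_of_support_subset _ _ fun x => ?_)⟩
    obtain ⟨τ, hτ, hgτ⟩ := (g x).2.2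
    refine ⟨insert v τ, hv τ (fun i hi => ?_) (.inr hτ), fun i hi => ?_, fun i hi => ?_⟩
    · obtain ⟨c, hc, rfl⟩ := hg x i ((hgτ i).1 hi)
      refine Finset.mem_image_of_mem _ (mem_latticeBox_of_abs_sub_lt fun i => ?_)
      have h1 := abs_lt.1 (isNearLattice_iff.1 hc i)
      have h2 := abs_le.1 (hbd x i)
      simp only [pow_zero, one_smul] at h1
      rw [abs_lt]
      constructor <;> norm_num <;> linarith
    · exact Finset.mem_insert_of_mem ((hgτ i).2 hi)
    · refine Finset.mem_insert.2 (.inl ?_)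
      by_contra h
      exact hi (by simp [y, h])
  | succ m ih =>
    obtain ⟨g, hfg, hg⟩ := hstep (m + 1) w f hf
    have hpow : ∀ x, (2 : ℝ) ^ (m + 1) • e x = (2 : ℝ) • (2 : ℝ) ^ m • e x := fun x => by
      rw [smul_smul, pow_succ']
    simp only [hpow] at hf hg
    obtain ⟨w', hw'⟩ := hK.exists_coarser_labelling (fun x => (2 : ℝ) ^ m • e x) (w := w)
      fun x => (hf x).imp fun σ hσ => ⟨hσ.1, hσ.2.2⟩
    obtain ⟨y, hy⟩ := ih w' g fun x => by
      obtain ⟨σ, hσ, h1, h2⟩ := hw' x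
      refine ⟨σ, hσ, fun i hi => ?_, h2⟩
      obtain ⟨c, hc, rfl⟩ := hg x i hi
      exact h1 c hc
    exact ⟨y, hfg.trans hy⟩

end PreAbstractSimplicialComplex

namespace PreAbstractSimplicialComplex

variable {ι : Type*} {K : PreAbstractSimplicialComplex ι} [Fintype ι] [DecidableEq ι]

/-- If small sets of vertices can be coned off, every map from a bounded compact subset of a
Euclidean space to the realization is null-homotopic. -/
theorem HasCones.nullhomotopic {X : Type*} [PseudoMetricSpace X] [CompactSpace X] {D : ℕ}
    (hK : K.HasCones (5 ^ D + 3 ^ D)) {e : X → Fin D → ℝ} (he : Continuous e)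
    (hbd : ∀ x i, |e x i| ≤ 1) {C : NNReal} (hC : AntilipschitzWith C e)
    (f : C(X, K.realization)) : f.Nullhomotopic := by
  obtain ⟨v₀, -⟩ := hK ∅ (by simp)
  have hcover : (Set.univ : Set X) ⊆ ⋃ v : ι, {x | (f x).1 v ≠ 0} := by
    intro x _
    obtain ⟨σ, hσ, h⟩ := (f x).2.2
    obtain ⟨i, hi⟩ := (K.isRelLowerSet_faces hσ).1
    exact Set.mem_iUnion.2 ⟨i, (h i).1 hi⟩
  have hopen : ∀ v : ι, IsOpen {x | (f x).1 v ≠ 0} := fun v =>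
    isOpen_ne_fun ((continuous_apply v).comp (continuous_subtype_val.comp f.continuous))
      continuous_const
  -- Lebesgue number of the cover by preimages of open vertex stars. Points in a common cube at
  -- scale `2 ^ m` are at distance at most `2 * C / 2 ^ m < δ`, so one star contains their images.
  obtain ⟨δ, hδ, hball⟩ := lebesgue_number_lemma_of_metric isCompact_univ hopen hcover
  obtain ⟨m, hm⟩ : ∃ m : ℕ, 2 * C / δ < (2 : ℝ) ^ m := pow_unbounded_of_one_lt _ one_lt_two
  have hlabel : ∀ c : Fin D → ℤ, ∃ v : ι, ∀ x, IsNearLattice c ((2 : ℝ) ^ m • e x) →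
      (f x).1 v ≠ 0 := by
    intro c
    by_cases h : ∃ x₀, IsNearLattice c ((2 : ℝ) ^ m • e x₀)
    · obtain ⟨x₀, hx₀⟩ := h
      obtain ⟨v, hv⟩ := hball x₀ (Set.mem_univ _)
      refine ⟨v, fun x hx => hv ?_⟩
      have h1 : dist ((2 : ℝ) ^ m • e x) ((2 : ℝ) ^ m • e x₀) < 2 := by
        calc _ ≤ _ := dist_triangle_right _ _ (fun i => (c i : ℝ))
          _ < 1 + 1 := add_lt_add hx hx₀
          _ = 2 := by norm_num
      rw [dist_smul₀, Real.norm_of_nonneg (by positivity)] at h1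
      have h2 := hC.le_mul_dist x x₀
      rw [div_lt_iff₀ hδ] at hm
      have h3 : (0 : ℝ) < 2 ^ m := by positivity
      rw [Metric.mem_ball]
      have h4 : (2 : ℝ) ^ m * dist x x₀ ≤ 2 * C := by
        nlinarith [C.2, mul_le_mul_of_nonneg_left h2 h3.le, mul_le_mul_of_nonneg_left h1.le C.2]
      exact lt_of_mul_lt_mul_left (h4.trans_lt hm) h3.le
    · exact ⟨v₀, fun x hx => absurd ⟨x, hx⟩ h⟩
  choose w hw using hlabel
  refine hK.nullhomotopic_of_labelling he hbd m w f fun x => ?_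
  obtain ⟨σ, hσ, h⟩ := (f x).2.2
  exact ⟨σ, hσ, fun i => (h i).2, fun c hc => (h _).2 (hw c x hc)⟩

theorem HasCones.isDConnected {d : ℕ} (hK : K.HasCones (5 ^ (d + 1) + 3 ^ (d + 1))) :
    IsDConnected d K.realization := by
  constructor
  · obtain ⟨v, hv⟩ := hK ∅ (by simp)
    have hvK : {v} ∈ K := by simpa using hv ∅ (by simp) (.inl rfl)
    exact ⟨⟨Pi.single v 1, mem_realization_of_support_subset
      (single_mem_stdSimplex ℝ v) hvK (by simp [Pi.single_apply])⟩⟩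
  · intro k hk f
    have hK' : K.HasCones (5 ^ (k + 1) + 3 ^ (k + 1)) :=
      hK.mono (by gcongr <;> norm_num)
    -- The sphere lies in `[-1, 1] ^ (k + 1)`; passing to the sup norm is antilipschitz.
    refine hK'.nullhomotopic (e := fun x i => x.1 i) (by fun_prop) (fun x i => ?_)
      ((PiLp.antilipschitzWith_ofLp 2 fun _ : Fin (k + 1) => ℝ).comp
        (AntilipschitzWith.subtype_coe _)) f
    have h := PiLp.norm_apply_le x.1 i
    rwa [mem_sphere_zero_iff_norm.1 x.2] at h

end PreAbstractSimplicialComplex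

/-! ### Probability that cone points exist. -/

/-- If `F v` are disjoint sets of at most `m` independent coins with success probabilities at
least `a`, it is exponentially unlikely that each of them contains an unsuccessful coin. -/
theorem measureReal_pi_forall_exists_false_le {T κ : Type*} [Fintype T] [DecidableEq T]
    [DecidableEq κ] (μ : T → Measure Bool) [∀ t, IsProbabilityMeasure (μ t)] {a : ℝ} (ha : 0 ≤ a)
    (ha1 : a ≤ 1) (hμ : ∀ t, a ≤ (μ t).real {true}) (F : κ → Finset T) {m : ℕ} (s : Finset κ)
    (hF : ∀ v ∈ s, (F v).card ≤ m) (hdisj : (s : Set κ).PairwiseDisjoint F) :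
    (Measure.pi μ).real {ω | ∀ v ∈ s, ∃ t ∈ F v, ω t = false} ≤ (1 - a ^ m) ^ s.card := by
  induction s using Finset.induction_on with
  | empty => simp
  | insert v s hv ih =>
    have ih' := ih (fun u hu => hF u (Finset.mem_insert_of_mem hu))
      (hdisj.subset (by simp))
    have hone : (Measure.pi μ).real {ω | ∃ t ∈ F v, ω t = false} ≤ 1 - a ^ m := by
      have hcompl : {ω : T → Bool | ∃ t ∈ F v, ω t = false} =
          (Set.univ.pi fun t => if t ∈ F v then {true} else Set.univ)ᶜ := by
        ext ω
        simp only [Set.mem_ofPred_eq, Set.mem_compl_iff, Set.mem_univ_pi, not_forall]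
        refine exists_congr fun t => ?_
        by_cases ht : t ∈ F v <;> simp [ht]
      rw [hcompl, probReal_compl_eq_one_sub (Set.toFinite _).measurableSet, measureReal_def,
        Measure.pi_pi, ENNReal.toReal_prod]
      have hprod : ∏ t, (μ t (if t ∈ F v then {true} else Set.univ)).toReal =
          ∏ t ∈ F v, (μ t).real {true} := by
        rw [← Finset.prod_subset (Finset.subset_univ (F v))]
        · exact Finset.prod_congr rfl fun t ht => by simp [ht, measureReal_def]
        · exact fun t _ ht => by rw [if_neg ht, measure_univ, ENNReal.toReal_one]
      rw [hprod, sub_le_sub_iff_left]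
      calc a ^ m ≤ a ^ (F v).card := pow_le_pow_of_le_one ha ha1 (hF v (by simp))
        _ = ∏ t ∈ F v, a := by simp
        _ ≤ _ := Finset.prod_le_prod (fun _ _ => ha) fun t _ => hμ t
    have hind : IndepFun (fun (ω : T → Bool) (t : F v) => ω t)
        (fun (ω : T → Bool) (t : s.biUnion F) => ω t) (Measure.pi μ) := by
      refine iIndepFun.indepFun_finset (f := fun t (ω : T → Bool) => ω t) _ _ ?_
        (iIndepFun_pi (X := fun _ => id) fun _ => aemeasurable_id) fun t => measurable_pi_apply t
      refine (Finset.disjoint_biUnion_right _ _ _).2 fun u hu => hdisj (by simp) (by simp [hu]) ?_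
      rintro rfl
      exact hv hu
    -- Independence applies once each event is written in terms of its own block of coordinates.
    have hmul := hind.measure_inter_preimage_eq_mul {x | ∃ t, x t = false}
      {x | ∀ u, ∀ hu : u ∈ s, ∃ t, ∃ ht : t ∈ F u,
        x ⟨t, Finset.mem_biUnion.2 ⟨u, hu, ht⟩⟩ = false}
      (Set.toFinite _).measurableSet (Set.toFinite _).measurableSet
    have hset : {ω : T → Bool | ∀ u ∈ insert v s, ∃ t ∈ F u, ω t = false} =
        {ω | ∃ t ∈ F v, ω t = false} ∩ {ω | ∀ u ∈ s, ∃ t ∈ F u, ω t = false} := by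
      ext ω
      simp
    simp only [Set.preimage_ofPred_eq, Subtype.exists, exists_prop] at hmul
    rw [hset, measureReal_def, hmul, ENNReal.toReal_mul, Finset.card_insert_of_notMem hv, pow_succ']
    exact mul_le_mul hone ih' ENNReal.toReal_nonneg (sub_nonneg.2 (pow_le_one₀ ha ha1))

instance {ι : Type*} [Fintype ι] (p : {σ : Finset ι // σ.Nonempty} → unitInterval) :
    IsProbabilityMeasure (coinMeasure p) := by
  unfold coinMeasure
  infer_instance

/-- The coins of the simplices spanned by `v` and a subset of `U`. -/
def coneCoins {ι : Type*} [DecidableEq ι] (U : Finset ι) (v : ι) :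
    Finset {σ : Finset ι // σ.Nonempty} :=
  U.powerset.image fun τ => ⟨insert v τ, Finset.insert_nonempty v τ⟩

/-- A face containing `v` has its coin in `coneCoins U v`; any other face lies in `σ`, whose coins
already succeeded. -/
theorem insert_mem_complexOfCoins {ι : Type*} [DecidableEq ι]
    {ω : {σ : Finset ι // σ.Nonempty} → Bool} {U : Finset ι} {v : ι}
    (h : ∀ τ ∈ coneCoins U v, ω τ = true) {σ : Finset ι} (hσU : σ ⊆ U)
    (hσ : σ = ∅ ∨ σ ∈ complexOfCoins ω) : insert v σ ∈ complexOfCoins ω := by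
  refine ⟨Finset.insert_nonempty v σ, fun τ hτ => ?_⟩
  by_cases hv : v ∈ τ.1
  · refine h τ (Finset.mem_image.2 ⟨τ.1.erase v, ?_, Subtype.ext (Finset.insert_erase hv)⟩)
    exact Finset.mem_powerset.2 ((Finset.subset_insert_iff.1 hτ).trans hσU)
  · have hτσ : τ.1 ⊆ σ := (Finset.subset_insert_iff_of_notMem hv).1 hτ
    rcases hσ with rfl | hσ
    · exact absurd (Finset.subset_empty.1 hτσ) τ.2.ne_empty
    · exact hσ.2 τ hτσ

/-- Union bound over the sets of size exactly `r`, with the points outside each set as candidates; a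
cone point over a set serves all its subsets. -/
theorem coinMeasure_real_not_hasCones_le {ι : Type*} [Fintype ι] [DecidableEq ι]
    (p : {σ : Finset ι // σ.Nonempty} → unitInterval) {a : ℝ} (ha : 0 ≤ a) (ha1 : a ≤ 1)
    (hp : ∀ σ, a ≤ (p σ : ℝ)) {r : ℕ} (hr : r ≤ Fintype.card ι) :
    (coinMeasure p).real {ω | ¬ (complexOfCoins ω).HasCones r} ≤
      (Fintype.card ι : ℝ) ^ r * (1 - a ^ 2 ^ r) ^ (Fintype.card ι - r) := by
  have hsub : {ω | ¬ (complexOfCoins ω).HasCones r} ⊆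
      ⋃ U ∈ Finset.powersetCard r (Finset.univ : Finset ι),
        {ω | ∀ v ∈ Uᶜ, ∃ t ∈ coneCoins U v, ω t = false} := by
    intro ω hω
    by_contra hno
    refine hω fun U hU => ?_
    obtain ⟨W, hUW, -, hW⟩ := Finset.exists_subsuperset_card_eq (Finset.subset_univ U) hU
      (by rwa [Finset.card_univ])
    simp only [Set.mem_iUnion, not_exists] at hno
    have h := hno W (Finset.mem_powersetCard.2 ⟨Finset.subset_univ W, hW⟩)
    simp only [Set.mem_ofPred_eq, not_forall, not_exists, not_and, Bool.not_eq_false] at h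
    obtain ⟨v, -, hv⟩ := h
    exact ⟨v, fun σ hσ hσK => insert_mem_complexOfCoins hv (hσ.trans hUW) hσK⟩
  have hbound : ∀ U ∈ Finset.powersetCard r (Finset.univ : Finset ι),
      (coinMeasure p).real {ω | ∀ v ∈ Uᶜ, ∃ t ∈ coneCoins U v, ω t = false} ≤
        (1 - a ^ 2 ^ r) ^ (Fintype.card ι - r) := by
    intro U hU
    have hcard := (Finset.mem_powersetCard.1 hU).2
    rw [← hcard, ← Finset.card_compl]
    refine measureReal_pi_forall_exists_false_le _ ha ha1 (fun σ => ?_) _ _ (fun v _ => ?_) ?_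
    · simpa using hp σ
    · exact Finset.card_image_le.trans (Finset.card_powerset U).le
    · intro v hv u hu hvu
      refine Finset.disjoint_left.2 fun τ hτv hτu => ?_
      obtain ⟨τ₁, h1, rfl⟩ := Finset.mem_image.1 hτv
      obtain ⟨τ₂, h2, h⟩ := Finset.mem_image.1 hτu
      -- A coin shared by `u` and `v` would put `v` in `U`, whereas candidates lie outside `U`.
      have hmem : v ∈ insert u τ₂ := by
        rw [show insert u τ₂ = insert v τ₁ from congrArg Subtype.val h]
        exact Finset.mem_insert_self _ _
      rcases Finset.mem_insert.1 hmem with h | h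
      · exact hvu h
      · simp only [Finset.coe_compl, Set.mem_compl_iff, Finset.mem_coe] at hv
        exact hv (Finset.mem_powerset.1 h2 h)
  calc _ ≤ _ := measureReal_mono hsub (measure_ne_top _ _)
    _ ≤ _ := measureReal_biUnion_finset_le _ _
    _ ≤ _ := Finset.sum_le_card_nsmul _ _ _ hbound
    _ ≤ _ := by
      rw [nsmul_eq_mul, Finset.card_powersetCard, Finset.card_univ]
      refine mul_le_mul_of_nonneg_right ?_
        (pow_nonneg (sub_nonneg.2 (pow_le_one₀ ha ha1)) _)
      exact_mod_cast Nat.choose_le_pow _ _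

theorem tendsto_coinMeasure_real_not_hasCones {a : ℝ} (ha : 0 < a) (ha1 : a < 1)
    (p : ∀ n : ℕ, {σ : Finset (Fin n) // σ.Nonempty} → unitInterval)
    (hp : ∀ n σ, a ≤ (p n σ : ℝ)) (r : ℕ) :
    Tendsto (fun n => (coinMeasure (p n)).real {ω | ¬ (complexOfCoins ω).HasCones r})
      atTop (𝓝 0) := by
  set q : ℝ := 1 - a ^ 2 ^ r with hq
  have hq0 : 0 < q := sub_pos.2 (pow_lt_one₀ ha.le ha1 (by positivity))
  have hq1 : q < 1 := by
    have : 0 < a ^ 2 ^ r := by positivity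
    linarith
  have hlim : Tendsto (fun n : ℕ => (n : ℝ) ^ r * q ^ n / q ^ r) atTop (𝓝 0) := by
    simpa using (tendsto_pow_const_mul_const_pow_of_abs_lt_one r
      (by rwa [abs_of_pos hq0])).div_const (q ^ r)
  refine squeeze_zero' (.of_forall fun n => measureReal_nonneg) ?_ hlim
  filter_upwards [eventually_ge_atTop r] with n hn
  refine (coinMeasure_real_not_hasCones_le (p n) ha.le ha1.le (hp n) (by simpa)).trans_eq ?_
  rw [Fintype.card_fin, ← hq, mul_div_assoc, pow_sub₀ q hq0.ne' hn, div_eq_mul_inv]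

theorem corollary5p2 (d : ℕ) (a b : ℝ) (ha : 0 < a) (hab : a < b) (hb : b < 1)
    (p : ∀ n : ℕ, {σ : Finset (Fin n) // σ.Nonempty} → unitInterval)
    (hp : ∀ (n : ℕ) (σ : {σ : Finset (Fin n) // σ.Nonempty}),
      a ≤ (p n σ : ℝ) ∧ (p n σ : ℝ) ≤ b) :
    Tendsto (fun n : ℕ => multiparameterProb (p n) fun K => IsDConnected d K.realization)
      atTop (𝓝 1) := by
  have h := (tendsto_coinMeasure_real_not_hasCones ha (hab.trans hb) p (fun n σ => (hp n σ).1)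
    (5 ^ (d + 1) + 3 ^ (d + 1))).const_sub 1
  rw [sub_zero] at h
  refine tendsto_of_tendsto_of_tendsto_of_le_of_le h tendsto_const_nhds (fun n => ?_)
    fun n => measureReal_le_one
  rw [sub_le_iff_le_add]
  calc (1 : ℝ) = (coinMeasure (p n)).real Set.univ := probReal_univ.symm
    _ ≤ (coinMeasure (p n)).real ({ω | IsDConnected d (complexOfCoins ω).realization} ∪
        {ω | ¬ (complexOfCoins ω).HasCones (5 ^ (d + 1) + 3 ^ (d + 1))}) := by
      refine measureReal_mono fun ω _ => ?_
      by_cases hω : (complexOfCoins ω).HasCones (5 ^ (d + 1) + 3 ^ (d + 1))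
      · exact .inl hω.isDConnected
      · exact .inr hω
    _ ≤ _ := measureReal_union_le _ _
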